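/- All graphs are finite and simple. A graph $H$ is a minor of a graph $G$ if a graph isomorphic to $H$ can be obtained from $G$ by repeatedly deleting vertices, deleting edges and contracting edges. For a real number $m$, a graph $G$ is called $m$-minor-universal if every graph with at most $m$ edges and with no isolated vertices is a minor of $G$. Let $Q_d$ denote the $d$-dimensional hypercube graph: its vertex set is $\mathbb{Z}_2^d$, and two vertices are adjacent if and only if their Hamming distance is $1$. There is an absolute constant $c>0$ such that for every integer $d\ge 1$ the hypercube $Q_d$ is $c\,\frac{2^d}{d}$-minor-universal. Moreover, there is an absolute constant $C>0$ such that for every integer $d\ge 1$ the hypercube $Q_d$ is not $\frac{C\,2^d}{\sqrt d}$-minor-universal. -/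

import Mathlib

namespace SimpleGraph

/-- Contraction of the edge `uv` of `G`: the vertices `u` and `v` are replaced by one new vertex
(`none`), which is adjacent to all the other neighbours of `u` and of `v`. -/
def contractEdge {V : Type*} (G : SimpleGraph V) (u v : V) :
    SimpleGraph (Option {x : V // x ≠ u ∧ x ≠ v}) where
  Adj a b :=
    match a, b with
    | none, none => False
    | none, some y => G.Adj u y ∨ G.Adj v y
    | some x, none => G.Adj u x ∨ G.Adj v x
    | some x, some y => G.Adj x y
  symm := ⟨by
    rintro (_ | x) (_ | y) h
    · exact h
    · exact h
    · exact h
    · exact G.adj_symm h⟩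
  loopless := ⟨by
    rintro (_ | x) h
    · exact h
    · exact G.irrefl h⟩

/-- `H.IsMinor G`: a graph isomorphic to `H` can be obtained from `G` by repeatedly deleting
vertices, deleting edges and contracting edges. -/
inductive IsMinor.{u, v} {W : Type u} (H : SimpleGraph W) : ∀ {V : Type v}, SimpleGraph V → Prop
  | iso {V : Type v} {G : SimpleGraph V} (e : G ≃g H) : IsMinor H G
  | deleteVertex {V : Type v} {G : SimpleGraph V} (v : V)
      (h : IsMinor H (G.induce {x | x ≠ v})) : IsMinor H G
  | deleteEdge {V : Type v} {G : SimpleGraph V} (e : Sym2 V) (he : e ∈ G.edgeSet)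
      (h : IsMinor H (G.deleteEdges {e})) : IsMinor H G
  | contract {V : Type v} {G : SimpleGraph V} (u v : V) (huv : G.Adj u v)
      (h : IsMinor H (G.contractEdge u v)) : IsMinor H G

/-- `G` is `m`-minor-universal: every finite graph with at most `m` edges and with no isolated
vertices is a minor of `G`. -/
def IsMinorUniversal {V : Type*} (G : SimpleGraph V) (m : ℝ) : Prop :=
  ∀ (W : Type) [Finite W] (H : SimpleGraph W),
    (∀ w, ¬ H.IsIsolated w) → (H.edgeSet.ncard : ℝ) ≤ m → H.IsMinor G

/-- The `d`-dimensional hypercube graph: the vertices are the elements of `(ZMod 2) ^ d`, two of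
them being adjacent when their Hamming distance is `1`. -/
def hypercube (d : ℕ) : SimpleGraph (Fin d → ZMod 2) where
  Adj x y := hammingDist x y = 1
  symm := ⟨fun x y h => (hammingDist_comm y x).trans h⟩
  loopless := ⟨fun x h => by simp at h⟩

end SimpleGraph

/-! Minors are handled through branch sets: `IsMinor.exists_model` and `IsMinorModel.isMinor` pass
between the two notions.

Not universal: a layer of $Q_d$ has at most $s=\binom{d}{\lfloor d/2\rfloor}\le 2^d/\sqrt d$
vertices, so it meets at most $s$ branch sets and separates those above it from those below. A
random graph on $4s$ vertices with at most $84s$ edges joins any two disjoint $s$-sets. In a model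
of it no layer can have $s$ branch sets on both sides; moving the layer upwards, the majority must
jump from above to below in one step, which is impossible (`not_isMinor_hypercube`).

Universal: list the darts of $H$ along a Gray code of $Q_k$, sorted by source, so that each vertex
of $H$ becomes a path. Some permutation $\pi$ of $Q_k$ makes the two darts of every edge adjacent,
so $H$ is a minor of `routingGraph π` (`exists_routingGraph_model`). A Beneš network factors $\pi$
into $2k$ permutations, each changing one coordinate (`exists_benes_factorization`). Each factor is
realised by disjoint strands in a copy of $Q_k\times C_4$, and these copies are stacked along a path
of length $O(d)$, itself inside a hypercube (`routingGraph_exists_model_hypercube`). Hence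
$2^{d-k}=O(d)$ suffices, and $2^k$ has order $2^d/d$. -/

namespace SimpleGraph

/-! ### Branch sets and their equivalence with minors -/

/-- A nonempty vertex set which every cut of it splits along an edge of `G`. -/
def CutConnected {V : Type*} (G : SimpleGraph V) (B : Set V) : Prop :=
  B.Nonempty ∧ ∀ S : Set V, (∃ x ∈ B, x ∈ S) → (∃ y ∈ B, y ∉ S) →
    ∃ x ∈ B, ∃ y ∈ B, x ∈ S ∧ y ∉ S ∧ G.Adj x y

/-- `B` is a family of branch sets witnessing that `H` is a minor of `G`. -/
structure IsMinorModel {V W : Type*} (H : SimpleGraph W) (G : SimpleGraph V) (B : W → Set V) :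
    Prop where
  connected : ∀ w, G.CutConnected (B w)
  disjoint : ∀ w w' x, x ∈ B w → x ∈ B w' → w = w'
  adj : ∀ w w', H.Adj w w' → ∃ x ∈ B w, ∃ y ∈ B w', G.Adj x y

lemma CutConnected.singleton {V : Type*} (G : SimpleGraph V) (x : V) : G.CutConnected {x} := by
  refine ⟨⟨x, rfl⟩, ?_⟩
  rintro S ⟨_, rfl, h⟩ ⟨_, rfl, h'⟩
  exact absurd h h'

open Classical in
/-- The quotient map of the contraction of `uv`. -/
noncomputable def contractMap {V : Type*} (u v : V) (x : V) : Option {x : V // x ≠ u ∧ x ≠ v} :=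
  if h : x ≠ u ∧ x ≠ v then some ⟨x, h⟩ else none

section contractMap

variable {V : Type*} {u v : V}

lemma contractMap_left : contractMap u v u = none := by simp [contractMap]

lemma contractMap_right : contractMap u v v = none := by simp [contractMap]

lemma contractMap_coe (x : {x : V // x ≠ u ∧ x ≠ v}) : contractMap u v (x : V) = some x := by
  simp [contractMap, x.2]

lemma contractMap_eq_none {x : V} : contractMap u v x = none ↔ x = u ∨ x = v := by
  unfold contractMap
  split_ifs with h
  · simp [h]
  · simp only [true_iff]; tauto

lemma contractMap_eq_some {x : V} {y : {x : V // x ≠ u ∧ x ≠ v}} :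
    contractMap u v x = some y ↔ x = y := by
  constructor
  · intro h
    unfold contractMap at h
    split_ifs at h with h'
    rw [← Option.some.inj h]
  · rintro rfl
    exact contractMap_coe y

lemma contractMap_eq_iff {x y : V} :
    contractMap u v x = contractMap u v y ↔ x = y ∨ (x = u ∨ x = v) ∧ (y = u ∨ y = v) := by
  constructor
  · intro h
    rcases hy : contractMap u v y with _ | z
    · rw [hy] at h
      exact Or.inr ⟨contractMap_eq_none.1 h, contractMap_eq_none.1 hy⟩
    · rw [hy] at h
      exact Or.inl ((contractMap_eq_some.1 h).trans (contractMap_eq_some.1 hy).symm)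
  · rintro (rfl | ⟨hx, hy⟩)
    · rfl
    · rw [contractMap_eq_none.2 hx, contractMap_eq_none.2 hy]

lemma contractMap_surjective : Function.Surjective (contractMap u v) := by
  rintro (_ | x)
  · exact ⟨u, contractMap_left⟩
  · exact ⟨x, contractMap_coe x⟩

/-- Presents the contraction as a quotient graph, which spares later arguments the case split on
`Option`. -/
lemma contractEdge_adj_iff {G : SimpleGraph V} {a b : Option {x : V // x ≠ u ∧ x ≠ v}} :
    (G.contractEdge u v).Adj a b ↔
      a ≠ b ∧ ∃ x y, contractMap u v x = a ∧ contractMap u v y = b ∧ G.Adj x y := by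
  rcases a with _ | a <;> rcases b with _ | b
  · simp
  · simp only [contractMap_eq_none, contractMap_eq_some]
    change (G.Adj u b ∨ G.Adj v b) ↔ _
    constructor
    · rintro (h | h)
      · exact ⟨by simp, u, b, Or.inl rfl, rfl, h⟩
      · exact ⟨by simp, v, b, Or.inr rfl, rfl, h⟩
    · rintro ⟨-, x, y, rfl | rfl, rfl, h⟩
      · exact Or.inl h
      · exact Or.inr h
  · simp only [contractMap_eq_none, contractMap_eq_some]
    change (G.Adj u a ∨ G.Adj v a) ↔ _
    constructor
    · rintro (h | h)
      · exact ⟨by simp, a, u, rfl, Or.inl rfl, h.symm⟩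
      · exact ⟨by simp, a, v, rfl, Or.inr rfl, h.symm⟩
    · rintro ⟨-, x, y, rfl, rfl | rfl, h⟩
      · exact Or.inl h.symm
      · exact Or.inr h.symm
  · simp only [contractMap_eq_some]
    change G.Adj a b ↔ _
    constructor
    · intro h
      exact ⟨fun e => h.ne (by rw [Option.some.inj e]), a, b, rfl, rfl, h⟩
    · rintro ⟨-, x, y, rfl, rfl, h⟩
      exact h

end contractMap

lemma CutConnected.map {V V' : Type*} {G : SimpleGraph V} {G' : SimpleGraph V'} (f : V → V')
    (hf : ∀ x y, f x ≠ f y → G.Adj x y → G'.Adj (f x) (f y)) {B : Set V}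
    (hB : G.CutConnected B) : G'.CutConnected (f '' B) := by
  refine ⟨hB.1.image f, ?_⟩
  rintro S ⟨_, ⟨x, hx, rfl⟩, hxS⟩ ⟨_, ⟨y, hy, rfl⟩, hyS⟩
  obtain ⟨a, ha, b, hb, haS, hbS, hab⟩ := hB.2 (f ⁻¹' S) ⟨x, hx, hxS⟩ ⟨y, hy, hyS⟩
  exact ⟨f a, ⟨a, ha, rfl⟩, f b, ⟨b, hb, rfl⟩, haS, hbS,
    hf a b (fun e => hbS (by simpa [Set.mem_preimage, ← e] using haS)) hab⟩

/-- The union of connected sets indexed by the points of a connected set is connected. -/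
lemma CutConnected.biUnion {V V' : Type*} {G : SimpleGraph V} {G' : SimpleGraph V'}
    {B : Set V'} (hB : G'.CutConnected B) {C : V' → Set V} (hC : ∀ v ∈ B, G.CutConnected (C v))
    (hadj : ∀ v ∈ B, ∀ v' ∈ B, G'.Adj v v' → ∃ x ∈ C v, ∃ y ∈ C v', G.Adj x y) :
    G.CutConnected (⋃ v ∈ B, C v) := by
  constructor
  · obtain ⟨v, hv⟩ := hB.1
    obtain ⟨x, hx⟩ := (hC v hv).1
    exact ⟨x, Set.mem_biUnion hv hx⟩
  rintro S ⟨x, hx, hxS⟩ ⟨y, hy, hyS⟩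
  by_cases hcut : ∃ v ∈ B, (∃ x ∈ C v, x ∈ S) ∧ ∃ y ∈ C v, y ∉ S
  · obtain ⟨v, hv, h1, h2⟩ := hcut
    obtain ⟨a, ha, b, hb, h⟩ := (hC v hv).2 S h1 h2
    exact ⟨a, Set.mem_biUnion hv ha, b, Set.mem_biUnion hv hb, h⟩
  · push Not at hcut
    obtain ⟨v, hv, hxv⟩ := Set.mem_iUnion₂.1 hx
    obtain ⟨v', hv', hyv'⟩ := Set.mem_iUnion₂.1 hy
    obtain ⟨a, ha, b, hb, haS, hbS, hab⟩ := hB.2 {v | ∃ x ∈ C v, x ∈ S} ⟨v, hv, x, hxv, hxS⟩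
      ⟨v', hv', fun h => hyS (hcut v' hv' h y hyv')⟩
    obtain ⟨p, hp, q, hq, hpq⟩ := hadj a ha b hb hab
    exact ⟨p, Set.mem_biUnion ha hp, q, Set.mem_biUnion hb hq, hcut a ha haS p hp,
      fun h => hbS ⟨q, hq, h⟩, hpq⟩

lemma IsMinorModel.trans {U V W : Type*} {H : SimpleGraph W} {G' : SimpleGraph U}
    {G : SimpleGraph V} {B : W → Set U} {C : U → Set V} (hB : H.IsMinorModel G' B)
    (hC : G'.IsMinorModel G C) : H.IsMinorModel G (fun w => ⋃ u ∈ B w, C u) where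
  connected w := (hB.connected w).biUnion (fun u _ => hC.connected u)
    (fun u _ u' _ h => hC.adj u u' h)
  disjoint w w' x hx hx' := by
    obtain ⟨u, hu, hxu⟩ := Set.mem_iUnion₂.1 hx
    obtain ⟨u', hu', hxu'⟩ := Set.mem_iUnion₂.1 hx'
    obtain rfl := hC.disjoint u u' x hxu hxu'
    exact hB.disjoint w w' u hu hu'
  adj w w' h := by
    obtain ⟨u, hu, u', hu', huu⟩ := hB.adj w w' h
    obtain ⟨x, hx, y, hy, hxy⟩ := hC.adj u u' huu
    exact ⟨x, Set.mem_biUnion hu hx, y, Set.mem_biUnion hu' hy, hxy⟩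

/-- An injective homomorphism gives a model whose branch sets are singletons. -/
lemma isMinorModel_of_injective {V W : Type*} {H : SimpleGraph W} {G : SimpleGraph V} (f : W → V)
    (hf : Function.Injective f) (hadj : ∀ w w', H.Adj w w' → G.Adj (f w) (f w')) :
    H.IsMinorModel G (fun w => {f w}) where
  connected _ := .singleton G _
  disjoint _ _ _ hx hx' := hf (hx.symm.trans hx')
  adj w w' h := ⟨_, rfl, _, rfl, hadj w w' h⟩

lemma isMinorModel_contractEdge {V : Type*} {G : SimpleGraph V} {u v : V} (huv : G.Adj u v) :
    (G.contractEdge u v).IsMinorModel G (fun a => {x | contractMap u v x = a}) where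
  connected a := by
    refine ⟨contractMap_surjective a, ?_⟩
    rintro S ⟨x, rfl, hxS⟩ ⟨y, hy, hyS⟩
    obtain rfl | ⟨hx, hy'⟩ := contractMap_eq_iff.1 hy
    · exact absurd hxS hyS
    · refine ⟨x, rfl, y, hy, hxS, hyS, ?_⟩
      have hne : x ≠ y := fun e => hyS (e ▸ hxS)
      rcases hx with rfl | rfl <;> rcases hy' with rfl | rfl
      · exact absurd rfl hne
      · exact huv.symm
      · exact huv
      · exact absurd rfl hne
  disjoint a b x hx hx' := hx.symm.trans hx'
  adj a b h := by
    obtain ⟨-, x, y, hx, hy, hxy⟩ := contractEdge_adj_iff.1 h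
    exact ⟨x, hx, y, hy, hxy⟩

/-- Each single operation has an evident model, and models compose by taking unions of branch sets.
-/
theorem IsMinor.exists_model {V W : Type*} {H : SimpleGraph W} {G : SimpleGraph V}
    (h : H.IsMinor G) : ∃ B, H.IsMinorModel G B := by
  induction h with
  | iso e =>
    exact ⟨_, isMinorModel_of_injective e.symm e.symm.injective fun _ _ h => e.symm.map_adj_iff.2 h⟩
  | deleteVertex v _ ih =>
    obtain ⟨B, hB⟩ := ih
    exact ⟨_, hB.trans (isMinorModel_of_injective Subtype.val Subtype.val_injective
      fun _ _ h => h)⟩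
  | @deleteEdge V G e he _ ih =>
    obtain ⟨B, hB⟩ := ih
    exact ⟨_, hB.trans (isMinorModel_of_injective id Function.injective_id
      fun _ _ h => G.deleteEdges_le {e} h)⟩
  | contract u v huv _ ih =>
    obtain ⟨B, hB⟩ := ih
    exact ⟨_, hB.trans (isMinorModel_contractEdge huv)⟩

theorem isMinor_of_bijective {V W : Type*} [Finite V] {H : SimpleGraph W}
    {G : SimpleGraph V} (f : W ≃ V) (hf : ∀ w w', H.Adj w w' → G.Adj (f w) (f w')) :
    H.IsMinor G := by
  induction hn : G.edgeSet.ncard using Nat.strong_induction_on generalizing G with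
  | _ n ih =>
    by_cases hG : ∃ w w', G.Adj (f w) (f w') ∧ ¬ H.Adj w w'
    · obtain ⟨w, w', hadj, hnot⟩ := hG
      refine .deleteEdge s(f w, f w') hadj (ih _ ?_ ?_ rfl)
      · rw [← hn]
        refine Set.ncard_lt_ncard ?_ (Set.toFinite _)
        rw [edgeSet_deleteEdges]
        exact Set.sdiff_singleton_ssubset.2 hadj
      · intro a b hab
        rw [deleteEdges_adj]
        refine ⟨hf a b hab, ?_⟩
        simp only [Set.mem_singleton_iff, Sym2.eq_iff, f.injective.eq_iff]
        rintro (⟨rfl, rfl⟩ | ⟨rfl, rfl⟩)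
        · exact hnot hab
        · exact hnot hab.symm
    · push Not at hG
      exact .iso (Iso.symm ⟨f, fun {a b} => ⟨hG a b, hf a b⟩⟩)

/-- Induction on the number of vertices: delete a vertex outside all branch sets, or contract an
edge inside a branch set. When neither is possible the branch sets are singletons covering the
graph, and only edges remain to be deleted. -/
theorem IsMinorModel.isMinor {V W : Type*} [Finite V] {H : SimpleGraph W}
    {G : SimpleGraph V} {B : W → Set V} (hB : H.IsMinorModel G B) : H.IsMinor G := by
  induction hn : Nat.card V using Nat.strong_induction_on generalizing V with
  | _ n ih =>
    by_cases hcov : ∃ v, ∀ w, v ∉ B w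
    · obtain ⟨v, hv⟩ := hcov
      have hne : ∀ w, ∀ x ∈ B w, x ≠ v := fun w x hx e => hv w (e ▸ hx)
      refine .deleteVertex v (ih _ ?_ (B := fun w => Subtype.val ⁻¹' B w) ⟨?_, ?_, ?_⟩ rfl)
      · rw [← hn]
        exact Finite.card_subtype_lt (x := v) (by simp)
      · intro w
        obtain ⟨x, hx⟩ := (hB.connected w).1
        refine ⟨⟨⟨x, hne w x hx⟩, hx⟩, ?_⟩
        rintro S ⟨a, ha, haS⟩ ⟨b, hb, hbS⟩
        obtain ⟨p, hp, q, hq, ⟨p', hpS, rfl⟩, hqS, hpq⟩ :=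
          (hB.connected w).2 (Subtype.val '' S) ⟨a, ha, a, haS, rfl⟩
            ⟨b, hb, fun ⟨c, hc, hcb⟩ => hbS (Subtype.ext hcb ▸ hc)⟩
        exact ⟨p', hp, ⟨q, hne w q hq⟩, hq, hpS, fun h => hqS ⟨_, h, rfl⟩, hpq⟩
      · exact fun w w' x hx hx' => hB.disjoint w w' x hx hx'
      · intro w w' h
        obtain ⟨x, hx, y, hy, hxy⟩ := hB.adj w w' h
        exact ⟨⟨x, hne w x hx⟩, hx, ⟨y, hne w' y hy⟩, hy, hxy⟩
    push Not at hcov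
    by_cases hbig : ∃ w, ∃ x ∈ B w, ∃ y ∈ B w, x ≠ y
    · obtain ⟨w₀, x, hx, y, hy, hne⟩ := hbig
      obtain ⟨u, hu, v, hv, -, -, huv⟩ :=
        (hB.connected w₀).2 {x} ⟨x, hx, rfl⟩ ⟨y, hy, fun e => hne e.symm⟩
      refine .contract u v huv
        (ih _ ?_ (B := fun w => contractMap u v '' B w) ⟨?_, ?_, ?_⟩ rfl)
      · rw [← hn]
        have := Fintype.ofFinite V
        have := Fintype.ofFinite {x : V // x ≠ u ∧ x ≠ v}
        rw [Nat.card_eq_fintype_card, Nat.card_eq_fintype_card]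
        exact Fintype.card_lt_of_surjective_not_injective _ contractMap_surjective
          fun h => huv.ne (h (contractMap_left.trans contractMap_right.symm))
      · exact fun w => (hB.connected w).map _
          fun x y hne h => contractEdge_adj_iff.2 ⟨hne, x, y, rfl, rfl, h⟩
      · rintro w w' _ ⟨p, hp, rfl⟩ ⟨q, hq, hqp⟩
        have hmem : ∀ z, z = u ∨ z = v → z ∈ B w₀ := by rintro z (rfl | rfl) <;> assumption
        obtain rfl | ⟨h1, h2⟩ := contractMap_eq_iff.1 hqp
        · exact hB.disjoint _ _ _ hp hq
        · exact (hB.disjoint _ _ _ hp (hmem _ h2)).trans (hB.disjoint _ _ _ (hmem _ h1) hq)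
      · intro w w' h
        obtain ⟨p, hp, q, hq, hpq⟩ := hB.adj w w' h
        refine ⟨_, ⟨p, hp, rfl⟩, _, ⟨q, hq, rfl⟩, contractEdge_adj_iff.2 ⟨?_, p, q, rfl, rfl, hpq⟩⟩
        have hmem : ∀ z, z = u ∨ z = v → z ∈ B w₀ := by rintro z (rfl | rfl) <;> assumption
        intro e
        obtain rfl | ⟨h1, h2⟩ := contractMap_eq_iff.1 e
        · exact hpq.ne rfl
        · exact h.ne ((hB.disjoint _ _ _ hp (hmem _ h1)).trans (hB.disjoint _ _ _ (hmem _ h2) hq))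
    · push Not at hbig
      choose f hf using fun w => (hB.connected w).1
      have hbij : Function.Bijective f := by
        constructor
        · intro w w' h
          exact hB.disjoint w w' _ (hf w) (h ▸ hf w')
        · intro v
          obtain ⟨w, hw⟩ := hcov v
          exact ⟨w, hbig w _ (hf w) _ hw⟩
      refine isMinor_of_bijective (Equiv.ofBijective f hbij) fun w w' h => ?_
      obtain ⟨x, hx, y, hy, hxy⟩ := hB.adj w w' h
      rw [hbig w x hx _ (hf w), hbig w' y hy _ (hf w')] at hxy
      exact hxy

/-! ### Layers of the hypercube as separators -/

lemma exists_switch {P : ℕ → Prop} {i j : ℕ} (hij : i ≤ j) (hi : P i) (hj : ¬ P j) :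
    ∃ t, i ≤ t ∧ t < j ∧ P t ∧ ¬ P (t + 1) := by
  induction j, hij using Nat.le_induction with
  | base => exact absurd hi hj
  | succ j hij ih =>
    by_cases h : P j
    · exact ⟨j, hij, j.lt_succ_self, h, hj⟩
    · obtain ⟨t, h1, h2, h3⟩ := ih h
      exact ⟨t, h1, h2.trans j.lt_succ_self, h3⟩

lemma card_hammingNorm_eq_le (d k : ℕ) :
    {x : Fin d → ZMod 2 | hammingNorm x = k}.ncard ≤ d.choose k := by
  classical
  have hcard : (Finset.powersetCard k (Finset.univ : Finset (Fin d))).card = d.choose k := by simp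
  rw [← hcard, ← Set.ncard_coe_finset]
  refine Set.ncard_le_ncard_of_injOn (fun x => Finset.univ.filter fun i => x i ≠ 0) ?_ ?_
    (Set.toFinite _)
  · intro x hx
    simpa [Finset.mem_powersetCard, hammingNorm] using hx
  · intro x _ y _ h
    funext i
    have h' : x i ≠ 0 ↔ y i ≠ 0 := by simpa using Finset.ext_iff.1 h i
    generalize x i = a at h'
    generalize y i = b at h'
    revert a b
    decide

lemma hammingNorm_le_of_adj {d : ℕ} {x y : Fin d → ZMod 2} (h : (hypercube d).Adj x y) :
    hammingNorm y ≤ hammingNorm x + 1 := by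
  have h1 : hammingDist x y = 1 := h
  have h2 := hammingDist_triangle 0 x y
  simp only [hammingDist_zero_left] at h2
  omega

/-- A connected vertex set of the hypercube which avoids a layer is on one side of it. -/
lemma CutConnected.lt_or_lt {d : ℕ} {B : Set (Fin d → ZMod 2)} (hB : (hypercube d).CutConnected B)
    {k : ℕ} (hk : ∀ x ∈ B, hammingNorm x ≠ k) :
    (∀ x ∈ B, hammingNorm x < k) ∨ ∀ x ∈ B, k < hammingNorm x := by
  by_contra! h
  obtain ⟨⟨x, hx, hxk⟩, y, hy, hyk⟩ := h
  obtain ⟨a, ha, b, hb, haS, hbS, hab⟩ := hB.2 {x | hammingNorm x < k}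
    ⟨y, hy, lt_of_le_of_ne hyk (hk y hy)⟩ ⟨x, hx, not_lt.2 hxk⟩
  have h1 := hammingNorm_le_of_adj hab
  have h2 := hk b hb
  simp only [Set.mem_ofPred_eq] at haS hbS
  omega

/-- A graph on `4 * s` vertices in which any two disjoint sets of `s` vertices are joined by an
edge is not a minor of a hypercube whose layers have at most `s` vertices. -/
theorem not_isMinor_hypercube {d s : ℕ} (hs : d.choose (d / 2) ≤ s)
    {H : SimpleGraph (Fin (4 * s))}
    (hH : ∀ A B : Set (Fin (4 * s)), Disjoint A B → s ≤ A.ncard → s ≤ B.ncard →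
      ∃ a ∈ A, ∃ b ∈ B, H.Adj a b) :
    ¬ H.IsMinor (hypercube d) := by
  intro hm
  obtain ⟨B, hB⟩ := hm.exists_model
  have hs0 : 0 < s := lt_of_lt_of_le (Nat.choose_pos (Nat.div_le_self d 2)) hs
  let up (k : ℕ) : Set (Fin (4 * s)) := {w | ∀ x ∈ B w, k < hammingNorm x}
  let down (k : ℕ) : Set (Fin (4 * s)) := {w | ∀ x ∈ B w, hammingNorm x < k}
  have hsep (k : ℕ) : (up k).ncard < s ∨ (down k).ncard < s := by
    by_contra! h
    have hdisj : Disjoint (up k) (down k) := by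
      refine Set.disjoint_left.2 fun w hw hw' => ?_
      obtain ⟨x, hx⟩ := (hB.connected w).1
      exact lt_asymm (hw x hx) (hw' x hx)
    obtain ⟨a, ha, b, hb, hab⟩ := hH _ _ hdisj h.1 h.2
    obtain ⟨x, hx, y, hy, hxy⟩ := hB.adj _ _ hab
    have h1 := hammingNorm_le_of_adj hxy.symm
    have h2 := ha x hx
    have h3 := hb y hy
    omega
  have hcount (k : ℕ) : 4 * s ≤ (up k).ncard + (down k).ncard + s := by
    have hmeet : (up k ∪ down k)ᶜ.ncard ≤ s := by
      have hex : ∀ w ∈ (up k ∪ down k)ᶜ, ∃ x ∈ B w, hammingNorm x = k := by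
        intro w hw
        by_contra! h
        exact hw ((hB.connected w).lt_or_lt h).symm
      choose! f hf hfk using hex
      refine le_trans ?_ ((card_hammingNorm_eq_le d k).trans ((Nat.choose_le_middle k d).trans hs))
      refine Set.ncard_le_ncard_of_injOn f hfk ?_ (Set.toFinite _)
      intro w hw w' hw' h
      exact hB.disjoint _ _ _ (hf w hw) (h ▸ hf w' hw')
    have h1 := Set.ncard_add_ncard_compl (up k ∪ down k)
    have h2 := Set.ncard_union_le (up k) (down k)
    rw [Nat.card_eq_fintype_card, Fintype.card_fin] at h1
    omega
  have hdown0 : (down 0).ncard = 0 := by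
    rw [Set.ncard_eq_zero]
    refine Set.eq_empty_of_forall_notMem fun w hw => ?_
    obtain ⟨x, hx⟩ := (hB.connected w).1
    exact absurd (hw x hx) (Nat.not_lt_zero _)
  have hupd : (up d).ncard = 0 := by
    rw [Set.ncard_eq_zero]
    refine Set.eq_empty_of_forall_notMem fun w hw => ?_
    obtain ⟨x, hx⟩ := (hB.connected w).1
    have := hammingNorm_le_card_fintype (x := x)
    rw [Fintype.card_fin] at this
    exact absurd (hw x hx) (not_lt.2 this)
  -- `up` has at least $3s$ members at level 0 and none at level $d$. At $t+1$ at most $2s$ remain,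
  -- so at least $s$ lie below; by `hsep` fewer than $s$ lie above, hence more than $2s$ below.
  obtain ⟨t, -, -, h1, h2⟩ := exists_switch (P := fun k => 2 * s < (up k).ncard) d.zero_le
    (by have := hcount 0; omega) (by omega)
  have h3 : 2 * s < (down (t + 1)).ncard := by
    have := hcount (t + 1)
    have := hsep (t + 1)
    omega
  have hdisj : Disjoint (up t) (down (t + 1)) := by
    refine Set.disjoint_left.2 fun w hw hw' => ?_
    obtain ⟨x, hx⟩ := (hB.connected w).1
    have := hw x hx
    have := hw' x hx
    omega
  have h4 := Set.ncard_union_eq hdisj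
  have h5 := Set.ncard_le_card (up t ∪ down (t + 1))
  rw [Nat.card_eq_fintype_card, Fintype.card_fin] at h5
  omega

/-! ### A sparse random graph joining all large sets -/

/-- The number of functions for which no value at `A` lies in `B`. -/
lemma card_avoiding {s K : ℕ} (A B : Finset (Fin (4 * s))) (hA : A.card = s) (hB : B.card = s) :
    (Fintype.piFinset fun p : Fin (4 * s) × Fin K =>
      if p.1 ∈ A then Bᶜ else Finset.univ).card = (3 * s) ^ (s * K) * (4 * s) ^ (3 * s * K) := by
  have hBc : Bᶜ.card = 3 * s := by
    rw [Finset.card_compl, hB, Fintype.card_fin]; omega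
  have hAc : (Finset.univ.filter fun a => a ∉ A).card = 3 * s := by
    rw [Finset.filter_notMem_eq_sdiff, ← Finset.compl_eq_univ_sdiff, Finset.card_compl, hA,
      Fintype.card_fin]
    omega
  rw [Fintype.card_piFinset, Fintype.prod_prod_type]
  have (a : Fin (4 * s)) : ∏ j : Fin K, (if (a, j).1 ∈ A then Bᶜ else Finset.univ).card =
      if a ∈ A then (3 * s) ^ K else (4 * s) ^ K := by
    split_ifs <;> simp [*]
  simp_rw [this]
  rw [Finset.prod_ite, Finset.prod_const, Finset.prod_const, hAc, Finset.filter_mem_eq_inter,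
    Finset.univ_inter, hA, ← pow_mul, ← pow_mul]
  ring

/-- A random graph of bounded average degree joins any two sets containing a quarter of the
vertices. -/
theorem exists_joining_function {s : ℕ} (hs : 0 < s) :
    ∃ f : Fin (4 * s) × Fin 20 → Fin (4 * s), ∀ A B : Finset (Fin (4 * s)),
      A.card = s → B.card = s → ∃ a ∈ A, ∃ j, f (a, j) ∈ B := by
  classical
  by_contra! h
  let bad (P : Finset (Fin (4 * s)) × Finset (Fin (4 * s))) :
      Finset (Fin (4 * s) × Fin 20 → Fin (4 * s)) :=
    Fintype.piFinset fun p => if p.1 ∈ P.1 then P.2ᶜ else Finset.univ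
  let pairs : Finset (Finset (Fin (4 * s)) × Finset (Fin (4 * s))) :=
    Finset.univ.filter fun P => P.1.card = s ∧ P.2.card = s
  have hcov : (Finset.univ : Finset (Fin (4 * s) × Fin 20 → Fin (4 * s))) ⊆ pairs.biUnion bad := by
    intro f _
    obtain ⟨A, B, hA, hB, hf⟩ := h f
    refine Finset.mem_biUnion.2 ⟨(A, B), by simp [pairs, hA, hB], ?_⟩
    refine Fintype.mem_piFinset.2 fun p => ?_
    by_cases hp : p.1 ∈ A
    · simpa [hp] using hf p.1 hp p.2
    · simp [hp]
  have hle := (Finset.card_le_card hcov).trans (Finset.card_biUnion_le_card_mul _ _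
    ((3 * s) ^ (s * 20) * (4 * s) ^ (3 * s * 20)) fun P hP => by
      obtain ⟨-, hP⟩ := Finset.mem_filter.1 hP
      exact (card_avoiding P.1 P.2 hP.1 hP.2).le)
  have hpairs : pairs.card ≤ 256 ^ s := by
    refine (Finset.card_le_univ _).trans ?_
    rw [Fintype.card_prod, Fintype.card_finset, Fintype.card_fin, ← pow_add]
    rw [show 4 * s + 4 * s = 8 * s by ring, pow_mul]
    norm_num
  -- The 20 choices per vertex come from here: $256\cdot 3^{20}<4^{20}$.
  have hlt : 256 ^ s * (3 * s) ^ (s * 20) < (4 * s) ^ (s * 20) := by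
    rw [mul_comm s 20, pow_mul, pow_mul, ← mul_pow]
    refine Nat.pow_lt_pow_left ?_ hs.ne'
    rw [mul_pow, mul_pow, ← mul_assoc]
    exact Nat.mul_lt_mul_of_pos_right (by norm_num) (pow_pos hs 20)
  rw [Finset.card_univ, Fintype.card_fun, Fintype.card_prod, Fintype.card_fin, Fintype.card_fin]
    at hle
  have hpos : 0 < (4 * s) ^ (3 * s * 20) := pow_pos (by omega) _
  have := calc (4 * s) ^ (4 * s * 20)
      ≤ 256 ^ s * ((3 * s) ^ (s * 20) * (4 * s) ^ (3 * s * 20)) :=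
        hle.trans (Nat.mul_le_mul_right _ hpairs)
    _ = 256 ^ s * (3 * s) ^ (s * 20) * (4 * s) ^ (3 * s * 20) := by ring
    _ < (4 * s) ^ (s * 20) * (4 * s) ^ (3 * s * 20) := Nat.mul_lt_mul_of_pos_right hlt hpos
    _ = (4 * s) ^ (4 * s * 20) := by rw [← pow_add]; congr 1; ring
  exact lt_irrefl _ this

/-- There are graphs with `n` vertices, `O(n)` edges and no isolated vertices in which any two disjoint
sets containing a quarter of the vertices are joined by an edge. -/
theorem exists_joining_graph {s : ℕ} (hs : 0 < s) :
    ∃ H : SimpleGraph (Fin (4 * s)), (∀ w, ¬ H.IsIsolated w) ∧ H.edgeSet.ncard ≤ 84 * s ∧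
      ∀ A B : Set (Fin (4 * s)), Disjoint A B → s ≤ A.ncard → s ≤ B.ncard →
        ∃ a ∈ A, ∃ b ∈ B, H.Adj a b := by
  classical
  obtain ⟨f, hf⟩ := exists_joining_function hs
  have hrev (v : Fin (4 * s)) : v ≠ v.rev := by
    intro h
    have := congrArg Fin.val h
    rw [Fin.val_rev] at this
    omega
  -- The edges to `v.rev` only serve to exclude isolated vertices; `rev` has no fixed point because
  -- $4s$ is even. With the 20 random edges this makes 21 per vertex, hence $84s$.
  refine ⟨fromRel fun v w => w = v.rev ∨ ∃ j, w = f (v, j), ?_, ?_, ?_⟩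
  · intro v hv
    exact hv v.rev ⟨hrev v, Or.inl (Or.inl rfl)⟩
  · let e (p : Fin (4 * s) × Option (Fin 20)) : Sym2 (Fin (4 * s)) :=
      s(p.1, p.2.elim p.1.rev fun j => f (p.1, j))
    have hsub : (fromRel fun v w : Fin (4 * s) => w = v.rev ∨ ∃ j, w = f (v, j)).edgeSet ⊆
        Set.range e := by
      intro x hx
      induction x with | _ v w
      rw [mem_edgeSet, fromRel_adj] at hx
      obtain ⟨-, (h | ⟨j, h⟩) | (h | ⟨j, h⟩)⟩ := hx <;> rw [h]
      · exact ⟨(v, none), rfl⟩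
      · exact ⟨(v, some j), rfl⟩
      · exact ⟨(w, none), Sym2.eq_swap⟩
      · exact ⟨(w, some j), Sym2.eq_swap⟩
    refine (Set.ncard_le_ncard hsub (Set.toFinite _)).trans ?_
    rw [← Set.image_univ]
    refine (Set.ncard_image_le (Set.toFinite _)).trans ?_
    rw [Set.ncard_univ, Nat.card_eq_fintype_card]
    simp only [Fintype.card_prod, Fintype.card_option, Fintype.card_fin]
    omega
  · intro A B hAB hA hB
    obtain ⟨A', hA', hAc⟩ := Set.exists_subset_card_eq hA
    obtain ⟨B', hB', hBc⟩ := Set.exists_subset_card_eq hB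
    obtain ⟨a, ha, j, hj⟩ := hf A'.toFinset B'.toFinset
      ((Set.ncard_eq_toFinset_card' A').symm.trans hAc)
      ((Set.ncard_eq_toFinset_card' B').symm.trans hBc)
    have ha' := hA' (Set.mem_toFinset.1 ha)
    have hj' := hB' (Set.mem_toFinset.1 hj)
    exact ⟨a, ha', _, hj', fun e => Set.disjoint_left.1 hAB ha' (e ▸ hj'),
      Or.inl (Or.inr ⟨j, rfl⟩)⟩

/-! ### Size of the middle layer and failure of universality -/

lemma sq_centralBinom_mul_le (n : ℕ) : n.centralBinom ^ 2 * (2 * n + 1) ≤ 4 ^ (2 * n) := by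
  induction n with
  | zero => simp
  | succ n ih =>
    have h := Nat.succ_mul_centralBinom_succ n
    refine le_of_mul_le_mul_left ?_ (pow_pos n.succ_pos 2)
    calc (n + 1) ^ 2 * ((n + 1).centralBinom ^ 2 * (2 * (n + 1) + 1))
        = ((n + 1) * (n + 1).centralBinom) ^ 2 * (2 * n + 3) := by ring
      _ = (n.centralBinom ^ 2 * (2 * n + 1)) * (4 * ((2 * n + 1) * (2 * n + 3))) := by
          rw [h]; ring
      _ ≤ 4 ^ (2 * n) * (16 * (n + 1) ^ 2) := by
          refine Nat.mul_le_mul ih ?_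
          nlinarith
      _ = (n + 1) ^ 2 * 4 ^ (2 * (n + 1)) := by
          rw [show 2 * (n + 1) = 2 * n + 2 by ring, pow_add]; ring

/-- For odd $d$ the middle coefficient is half of the next central binomial coefficient. -/
lemma sq_choose_middle_mul_le (d : ℕ) : d.choose (d / 2) ^ 2 * d ≤ 4 ^ d := by
  obtain ⟨n, rfl | rfl⟩ := Nat.even_or_odd' d
  · rw [Nat.mul_div_cancel_left n two_pos]
    exact (Nat.mul_le_mul_left _ (Nat.le_succ _)).trans (sq_centralBinom_mul_le n)
  · rw [show (2 * n + 1) / 2 = n by omega]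
    have h1 : (n + 1).centralBinom = 2 * (2 * n + 1).choose n := by
      rw [Nat.centralBinom_eq_two_mul_choose, show 2 * (n + 1) = 2 * n + 1 + 1 by ring,
        Nat.choose_succ_succ, Nat.choose_symm_half]
      ring
    have h2 := sq_centralBinom_mul_le (n + 1)
    rw [h1, show 2 * (n + 1) = 2 * n + 1 + 1 by ring, pow_succ 4 (2 * n + 1)] at h2
    nlinarith [sq_nonneg ((2 * n + 1).choose n)]

theorem not_isMinorUniversal_hypercube {d : ℕ} (hd : 1 ≤ d) :
    ¬ (hypercube d).IsMinorUniversal (84 * 2 ^ d / Real.sqrt d) := by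
  intro h
  have hs : 0 < d.choose (d / 2) := Nat.choose_pos (Nat.div_le_self d 2)
  obtain ⟨H, hiso, hcard, hjoin⟩ := exists_joining_graph hs
  refine not_isMinor_hypercube le_rfl hjoin (h _ H hiso ?_)
  have hsqrt : 0 < Real.sqrt d := Real.sqrt_pos.2 (by exact_mod_cast hd)
  rw [le_div_iff₀ hsqrt]
  have hmid : (d.choose (d / 2) : ℝ) * Real.sqrt d ≤ 2 ^ d := by
    refine (sq_le_sq₀ (mul_nonneg (Nat.cast_nonneg _) hsqrt.le) (by positivity)).1 ?_
    rw [mul_pow, Real.sq_sqrt (Nat.cast_nonneg d), ← pow_mul, mul_comm d 2, pow_mul]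
    norm_num
    exact_mod_cast sq_choose_middle_mul_le d
  calc (H.edgeSet.ncard : ℝ) * Real.sqrt d
      ≤ 84 * d.choose (d / 2) * Real.sqrt d := by
        gcongr
        exact_mod_cast hcard
    _ = 84 * (d.choose (d / 2) * Real.sqrt d) := by ring
    _ ≤ 84 * 2 ^ d := by gcongr

/-! ### Hamming distance in coordinates and Gray codes -/

section Hypercube

lemma hypercube_adj_of_ne {n : ℕ} {x y : Fin n → ZMod 2} (i : Fin n) (hne : x ≠ y)
    (h : ∀ j, j ≠ i → x j = y j) : (hypercube n).Adj x y := by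
  change (Finset.univ.filter fun j => x j ≠ y j).card = 1
  refine Finset.card_eq_one.2 ⟨i, ?_⟩
  ext j
  simp only [Finset.mem_filter, Finset.mem_univ, true_and, Finset.mem_singleton]
  refine ⟨fun hj => by_contra fun hji => hj (h j hji), ?_⟩
  rintro rfl hj
  exact hne (funext fun a => if ha : a = j then ha ▸ hj else h a ha)

lemma hammingDist_append {a b : ℕ} (x x' : Fin a → ZMod 2) (y y' : Fin b → ZMod 2) :
    hammingDist (Fin.append x y) (Fin.append x' y') = hammingDist x x' + hammingDist y y' := by
  simp only [hammingDist, Finset.card_filter, Fin.sum_univ_add, Fin.append_left, Fin.append_right]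

lemma hammingDist_cons {n : ℕ} (p p' : ZMod 2) (y y' : Fin n → ZMod 2) :
    hammingDist (Fin.cons p y : Fin (n + 1) → ZMod 2) (Fin.cons p' y') =
      (if p ≠ p' then 1 else 0) + hammingDist y y' := by
  simp only [hammingDist, Finset.card_filter, Fin.sum_univ_succ, Fin.cons_zero, Fin.cons_succ]

/-- A Gray code: a Hamiltonian path of the hypercube. -/
lemma exists_grayCode (n : ℕ) : ∃ g : ℕ → Fin n → ZMod 2, Set.InjOn g (Set.Iio (2 ^ n)) ∧
    ∀ i, i + 1 < 2 ^ n → (hypercube n).Adj (g i) (g (i + 1)) := by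
  induction n with
  | zero =>
    refine ⟨fun _ => 0, fun i hi j hj _ => ?_, fun i hi => by simp at hi⟩
    simp only [pow_zero, Set.mem_Iio] at hi hj
    omega
  | succ n ih =>
    obtain ⟨g, hg, hadj⟩ := ih
    have hpow : 2 ^ (n + 1) = 2 * 2 ^ n := by ring
    -- Reflected code: the second half runs through `g` backwards.
    let g' (i : ℕ) : Fin (n + 1) → ZMod 2 :=
      if i < 2 ^ n then Fin.cons 0 (g i) else Fin.cons 1 (g (2 ^ (n + 1) - 1 - i))
    have hlow (i : ℕ) (hi : i < 2 ^ n) : g' i = Fin.cons 0 (g i) := if_pos hi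
    have hhigh (i : ℕ) (hi : ¬ i < 2 ^ n) : g' i = Fin.cons 1 (g (2 ^ (n + 1) - 1 - i)) :=
      if_neg hi
    refine ⟨g', fun i hi j hj h => ?_, fun i hi => ?_⟩
    · rw [Set.mem_Iio] at hi hj
      by_cases h1 : i < 2 ^ n <;> by_cases h2 : j < 2 ^ n
      · rw [hlow i h1, hlow j h2, Fin.cons_inj] at h
        exact hg h1 h2 h.2
      · rw [hlow i h1, hhigh j h2, Fin.cons_inj] at h
        exact absurd h.1 (by decide)
      · rw [hhigh i h1, hlow j h2, Fin.cons_inj] at h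
        exact absurd h.1 (by decide)
      · rw [hhigh i h1, hhigh j h2, Fin.cons_inj] at h
        have := hg (Set.mem_Iio.2 (by omega)) (Set.mem_Iio.2 (by omega)) h.2
        omega
    · change hammingDist _ _ = 1
      by_cases h1 : i + 1 < 2 ^ n
      · rw [hlow i (by omega), hlow _ h1, hammingDist_cons]
        simpa using show hammingDist _ _ = 1 from hadj i h1
      · by_cases h2 : i < 2 ^ n
        · rw [hlow i h2, hhigh _ h1, hammingDist_cons,
            show 2 ^ (n + 1) - 1 - (i + 1) = i by omega]
          simp
        · rw [hhigh i h2, hhigh _ h1, hammingDist_cons]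
          have := hadj (2 ^ (n + 1) - 1 - (i + 1)) (by omega)
          rw [show 2 ^ (n + 1) - 1 - (i + 1) + 1 = 2 ^ (n + 1) - 1 - i by omega] at this
          simpa using show hammingDist _ _ = 1 from this.symm

end Hypercube

/-! ### Beneš factorization of permutations of the cube -/

section Benes

/-- Two fixed-point-free involutions have a common proper two-colouring. -/
theorem exists_two_coloring {Ω : Type*} (s t : Equiv.Perm Ω) (hs : s * s = 1) (ht : t * t = 1)
    (hs' : ∀ x, s x ≠ x) (ht' : ∀ x, t x ≠ x) :
    ∃ c : Ω → ZMod 2, (∀ x, c (s x) ≠ c x) ∧ ∀ x, c (t x) ≠ c x := by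
  classical
  have hsinv : s⁻¹ = s := inv_eq_of_mul_eq_one_left hs
  have htinv : t⁻¹ = t := inv_eq_of_mul_eq_one_left ht
  have hss (x : Ω) : s (s x) = x := congrArg (· x) hs
  let ρ := s * t
  have hconj : s * ρ * s⁻¹ = ρ⁻¹ := by
    simp only [ρ, mul_inv_rev, hsinv, htinv, ← mul_assoc, hs, one_mul]
  have hcomm (n : ℤ) (x : Ω) : s ((ρ ^ n) x) = (ρ ^ (-n)) (s x) := by
    have h : s * ρ ^ n = ρ ^ (-n) * s := by
      rw [zpow_neg, ← inv_zpow, ← hconj, conj_zpow, inv_mul_cancel_right]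
    exact congrArg (· x) h
  have ht_eq (x : Ω) : t x = s (ρ x) := (hss (t x)).symm
  -- If $\rho^n x=s x$, then $\rho^m x$ is fixed by $s$ when $n=2m$ and by $t$ when $n=2m+1$, since
  -- $s$ inverts $\rho$.
  have hcycle (x : Ω) : ¬ ρ.SameCycle x (s x) := by
    rintro ⟨n, hn⟩
    obtain ⟨m, rfl | rfl⟩ := Int.even_or_odd' n
    · refine hs' ((ρ ^ m) x) ?_
      rw [hcomm, ← hn, ← Equiv.Perm.mul_apply, ← zpow_add]
      congr 2; ring
    · refine ht' ((ρ ^ m) x) ?_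
      rw [ht_eq, ← Equiv.Perm.mul_apply ρ, ← zpow_one_add, hcomm, ← hn, ← Equiv.Perm.mul_apply,
        ← zpow_add]
      congr 2; ring
  let mk (x : Ω) : Quotient (Equiv.Perm.SameCycle.setoid ρ) := Quotient.mk _ x
  have hmk (x : Ω) : mk (s (ρ x)) = mk (s x) := by
    refine Quotient.sound ?_
    change ρ.SameCycle _ _
    have := hcomm 1 x
    rw [zpow_one] at this
    rw [this]
    exact ⟨1, by rw [← Equiv.Perm.mul_apply, ← zpow_add]; simp⟩
  have hne (x : Ω) : mk x ≠ mk (s x) := fun h => hcycle x (Quotient.exact h)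
  -- Both $s$ and $t$ interchange the $\rho$-cycles of $x$ and $s x$; an arbitrary order on cycles
  -- decides which of the two gets colour 1.
  let r := @WellOrderingRel (Quotient (Equiv.Perm.SameCycle.setoid ρ))
  have hr (x : Ω) : r (mk (s x)) (mk x) ↔ ¬ r (mk x) (mk (s x)) := by
    constructor
    · exact fun h h' => asymm_of r h h'
    · intro h
      rcases trichotomous_of r (mk x) (mk (s x)) with h' | h' | h'
      · exact absurd h' h
      · exact absurd h' (hne x)
      · exact h'
  have hts (x : Ω) : mk (s (t x)) = mk x := by
    refine Quotient.sound ?_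
    change ρ.SameCycle (ρ x) x
    exact ⟨-1, by simp⟩
  have hmkt (x : Ω) : mk (t x) = mk (s x) := by rw [ht_eq, hmk]
  refine ⟨fun x => if r (mk x) (mk (s x)) then 1 else 0, fun x => ?_, fun x => ?_⟩
  · simp only [hss, hr]
    by_cases h : r (mk x) (mk (s x)) <;> simp [h]
  · simp only [hts, hmkt, hr]
    by_cases h : r (mk x) (mk (s x)) <;> simp [h]

variable {k : ℕ}

/-- A permutation of the hypercube changing at most the `i`-th coordinate of each vertex. -/
def IsDirectional (i : Fin k) (σ : Equiv.Perm (Fin k → ZMod 2)) : Prop :=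
  ∀ x j, j ≠ i → σ x j = x j

lemma IsDirectional.inv {i : Fin k} {σ : Equiv.Perm (Fin k → ZMod 2)} (h : IsDirectional i σ) :
    IsDirectional i σ⁻¹ := fun x j hj => by
  have := h (σ.symm x) j hj
  rw [Equiv.apply_symm_apply] at this
  exact this.symm

lemma IsDirectional.one (i : Fin k) : IsDirectional i 1 := fun _ _ _ => rfl

/-- The permutation flipping the `i`-th coordinate. -/
def flipPerm (i : Fin k) : Equiv.Perm (Fin k → ZMod 2) :=
  Function.Involutive.toPerm (fun x => Function.update x i (x i + 1)) fun x => by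
    have : x i + 1 + 1 = x i := by rw [add_assoc, show (1 + 1 : ZMod 2) = 0 by decide, add_zero]
    simp [this]

lemma flipPerm_apply (i : Fin k) (x : Fin k → ZMod 2) :
    flipPerm i x = Function.update x i (x i + 1) := rfl

lemma flipPerm_ne (i : Fin k) (x : Fin k → ZMod 2) : flipPerm i x ≠ x := fun h => by
  have := congrFun h i
  rw [flipPerm_apply, Function.update_self] at this
  simp at this

lemma flipPerm_mul_self (i : Fin k) : flipPerm i * flipPerm i = 1 :=
  Equiv.ext (Function.Involutive.toPerm_involutive _)

/-- The map permutes each pair $\{x,$ `flipPerm i x` $\}$, because `c` takes both values on it. -/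
lemma exists_perm_update (i : Fin k) (c : (Fin k → ZMod 2) → ZMod 2)
    (hc : ∀ x, c (flipPerm i x) ≠ c x) :
    ∃ b : Equiv.Perm (Fin k → ZMod 2), ∀ x, b x = Function.update x i (c x) := by
  have hinj : Function.Injective fun x => Function.update x i (c x) := by
    intro x y h
    have hi : c x = c y := by simpa using congrFun h i
    have hj (j : Fin k) (hj : j ≠ i) : x j = y j := by simpa [hj] using congrFun h j
    by_contra hne
    have hxy : y i = x i + 1 := by
      have : x i ≠ y i := fun e => hne (funext fun j => if h : j = i then h ▸ e else hj j h)
      generalize x i = a at this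
      generalize y i = b at this
      revert a b; decide
    refine hc x ?_
    rw [hi]
    congr 1
    funext j
    rw [flipPerm_apply]
    by_cases h : j = i
    · rw [h, Function.update_self, hxy]
    · rw [Function.update_of_ne h, hj j h]
  exact ⟨Equiv.ofBijective _ (Finite.injective_iff_bijective.1 hinj), fun _ => rfl⟩

/-- The recursive step of the Beneš network. -/
lemma exists_benes_step (i : Fin k) (π : Equiv.Perm (Fin k → ZMod 2))
    (hπ : ∀ x j, j < i → π x j = x j) :
    ∃ a π' b : Equiv.Perm (Fin k → ZMod 2), π = a * π' * b ∧ IsDirectional i a ∧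
      IsDirectional i b ∧ ∀ x j, j ≤ i → π' x j = x j := by
  -- The colouring separates each $i$-pair and also the preimage under `π` of each $i$-pair. So the
  -- colour can be written into coordinate `i` both before and after `π`, and the permutation in
  -- between preserves that coordinate.
  obtain ⟨c, hcs, hct⟩ := exists_two_coloring (flipPerm i) (π⁻¹ * flipPerm i * π)
    (flipPerm_mul_self i)
    (by
      rw [show π⁻¹ * flipPerm i * π * (π⁻¹ * flipPerm i * π) =
        π⁻¹ * (flipPerm i * flipPerm i) * π by group]
      rw [flipPerm_mul_self]; group)
    (flipPerm_ne i)
    (fun x h => flipPerm_ne i (π x) (Equiv.Perm.inv_eq_iff_eq.1 h))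
  obtain ⟨b, hb⟩ := exists_perm_update i c hcs
  obtain ⟨a, ha⟩ := exists_perm_update i (fun y => c (π⁻¹ y)) fun y => by
    simpa using hct (π⁻¹ y)
  have hdir {σ : Equiv.Perm (Fin k → ZMod 2)} {c : (Fin k → ZMod 2) → ZMod 2}
      (h : ∀ x, σ x = Function.update x i (c x)) : IsDirectional i σ := fun x j hj => by
    rw [h, Function.update_of_ne hj]
  refine ⟨a⁻¹, a * π * b⁻¹, b, by group, (hdir ha).inv, hdir hb, fun x j hj => ?_⟩
  obtain ⟨z, rfl⟩ := b.surjective x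
  have hπ' : (a * π * b⁻¹) (b z) = a (π z) := congrArg (fun y => a (π y)) (b.symm_apply_apply z)
  have hc : c (π⁻¹ (π z)) = c z := congrArg c (π.symm_apply_apply z)
  rw [hπ', ha, hb, hc]
  obtain rfl | hlt := hj.eq_or_lt
  · rw [Function.update_self, Function.update_self]
  · rw [Function.update_of_ne hlt.ne, Function.update_of_ne hlt.ne, hπ z j hlt]

/-- Every permutation of the hypercube is a product of `2 * k` directional permutations. -/
theorem exists_benes_factorization (π : Equiv.Perm (Fin k → ZMod 2)) :
    ∃ l : List (Equiv.Perm (Fin k → ZMod 2)), l.length = 2 * k ∧ l.prod = π ∧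
      ∀ σ ∈ l, ∃ i, IsDirectional i σ := by
  suffices H : ∀ n i, i + n = k → ∀ π : Equiv.Perm (Fin k → ZMod 2),
      (∀ x (j : Fin k), (j : ℕ) < i → π x j = x j) →
      ∃ l : List (Equiv.Perm (Fin k → ZMod 2)), l.length = 2 * n ∧ l.prod = π ∧
        ∀ σ ∈ l, ∃ i, IsDirectional i σ from
    H k 0 (Nat.zero_add k) π fun _ _ h => absurd h (Nat.not_lt_zero _)
  intro n
  induction n with
  | zero =>
    intro i hi π hπ
    refine ⟨[], rfl, ?_, by simp⟩
    exact Equiv.ext fun x => funext fun j => (hπ x j (by omega)).symm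
  | succ n ih =>
    intro i hi π hπ
    obtain ⟨a, π', b, rfl, ha, hb, hπ'⟩ := exists_benes_step ⟨i, by omega⟩ π fun x j hj => hπ x j hj
    obtain ⟨l, hl, rfl, hdir⟩ := ih (i + 1) (by omega) π' fun x j hj =>
      hπ' x j (Fin.le_def.2 (Nat.lt_succ_iff.1 hj))
    refine ⟨a :: (l ++ [b]), by simp [hl]; ring, by simp [mul_assoc], ?_⟩
    intro σ hσ
    simp only [List.mem_cons, List.mem_append, List.not_mem_nil, or_false] at hσ
    rcases hσ with rfl | hσ | rfl
    · exact ⟨_, ha⟩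
    · exact hdir σ hσ
    · exact ⟨_, hb⟩

/-- The composite of the first `j` permutations of a sequence. -/
def compositePerm {Ω : Type*} (σ : ℕ → Equiv.Perm Ω) : ℕ → Equiv.Perm Ω
  | 0 => 1
  | j + 1 => σ j * compositePerm σ j

lemma compositePerm_congr {Ω : Type*} {σ σ' : ℕ → Equiv.Perm Ω} {j : ℕ}
    (h : ∀ i < j, σ i = σ' i) : compositePerm σ j = compositePerm σ' j := by
  induction j with
  | zero => rfl
  | succ j ih =>
    rw [compositePerm, compositePerm, h j j.lt_succ_self,
      ih fun i hi => h i (hi.trans j.lt_succ_self)]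

/-- Padding with identities lets the number of slabs be any sufficiently large number, such as a
power of two. The head of the list acts last. -/
lemma exists_directional_sequence (i₀ : Fin k) (l : List (Equiv.Perm (Fin k → ZMod 2)))
    (hl : ∀ σ ∈ l, ∃ i, IsDirectional i σ) :
    ∃ σ : ℕ → Equiv.Perm (Fin k → ZMod 2), (∀ j, ∃ i, IsDirectional i (σ j)) ∧
      ∀ j, l.length ≤ j → compositePerm σ j = l.prod := by
  induction l with
  | nil =>
    refine ⟨fun _ => 1, fun _ => ⟨i₀, .one i₀⟩, fun j _ => ?_⟩
    induction j with
    | zero => rfl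
    | succ j ih => rw [compositePerm, ih (Nat.zero_le j)]; rfl
  | cons a l ih =>
    obtain ⟨σ, hσ, hcomp⟩ := ih fun σ h => hl σ (List.mem_cons_of_mem a h)
    refine ⟨fun j => if j < l.length then σ j else if j = l.length then a else 1, ?_, ?_⟩
    · intro j
      dsimp only
      split_ifs
      · exact hσ j
      · exact hl a List.mem_cons_self
      · exact ⟨i₀, .one i₀⟩
    · intro j hj
      rw [List.length_cons] at hj
      induction j, hj using Nat.le_induction with
      | base =>
        rw [compositePerm, compositePerm_congr (σ' := σ) fun i hi => if_pos hi, hcomp _ le_rfl,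
          List.prod_cons]
        simp
      | succ j hj ih =>
        rw [compositePerm, ih, if_neg (by omega), if_neg (by omega), one_mul]

end Benes

/-! ### Constructing connected sets -/

lemma CutConnected.insert {V : Type*} {G : SimpleGraph V} {B : Set V} (hB : G.CutConnected B)
    {x : V} (hx : ∃ y ∈ B, x = y ∨ G.Adj x y) : G.CutConnected (insert x B) := by
  obtain ⟨y, hy, rfl | hxy⟩ := hx
  · rwa [Set.insert_eq_of_mem hy]
  refine ⟨⟨x, Set.mem_insert _ _⟩, fun S h1 h2 => ?_⟩
  by_cases hcut : (∃ a ∈ B, a ∈ S) ∧ ∃ b ∈ B, b ∉ S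
  · obtain ⟨a, ha, b, hb, h⟩ := hB.2 S hcut.1 hcut.2
    exact ⟨a, Or.inr ha, b, Or.inr hb, h⟩
  · by_cases hyS : y ∈ S
    · have hall : ∀ b ∈ B, b ∈ S := fun b hb => by_contra fun h => hcut ⟨⟨y, hy, hyS⟩, b, hb, h⟩
      obtain ⟨b, rfl | hb, hbS⟩ := h2
      · exact ⟨y, Or.inr hy, b, Or.inl rfl, hyS, hbS, hxy.symm⟩
      · exact absurd (hall b hb) hbS
    · have hall : ∀ b ∈ B, b ∉ S := fun b hb h => hcut ⟨⟨b, hb, h⟩, y, hy, hyS⟩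
      obtain ⟨b, rfl | hb, hbS⟩ := h1
      · exact ⟨b, Or.inl rfl, y, Or.inr hy, hbS, hyS, hxy⟩
      · exact absurd hbS (hall b hb)

lemma cutConnected_pathGraph {n : ℕ} {I : Set (Fin n)} (hne : I.Nonempty) (hI : I.OrdConnected) :
    (pathGraph n).CutConnected I := by
  refine ⟨hne, ?_⟩
  have key (S : Set (Fin n)) (a b : Fin n) (ha : a ∈ I) (hb : b ∈ I) (hab : a ≤ b) (haS : a ∈ S)
      (hbS : b ∉ S) : ∃ x ∈ I, ∃ y ∈ I, x ∈ S ∧ y ∉ S ∧ (pathGraph n).Adj x y := by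
    obtain ⟨t, h1, h2, ⟨ht, htS⟩, h3⟩ := exists_switch (P := fun i => ∃ h : i < n, ⟨i, h⟩ ∈ S)
      (Fin.le_def.1 hab) ⟨a.2, haS⟩ (fun ⟨_, h⟩ => hbS h)
    have hb2 := b.2
    exact ⟨⟨t, ht⟩, hI.out ha hb ⟨h1, h2.le⟩, ⟨t + 1, by omega⟩,
      hI.out ha hb ⟨Fin.le_def.2 (Nat.le_succ_of_le h1), h2⟩, htS, fun h => h3 ⟨_, h⟩,
      pathGraph_adj.2 (Or.inl rfl)⟩
  rintro S ⟨a, ha, haS⟩ ⟨b, hb, hbS⟩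
  rcases le_total a b with hab | hab
  · exact key S a b ha hb hab haS hbS
  · obtain ⟨x, hx, y, hy, hxS, hyS, hxy⟩ := key Sᶜ b a hb ha hab hbS (not_not.2 haS)
    exact ⟨y, hy, x, hx, not_not.1 hyS, hxS, hxy.symm⟩

/-! ### Routing disjoint strands through slabs -/

section Slab

variable {k : ℕ}

/-- The vertices of a hypercube times a four-cycle used by the strand entering at `x` and leaving at
`σ x`, where `σ` changes only the `i`-th coordinate. Strands enter at the corner `(p, p)` of the
four-cycle, leave at the opposite corner, and pass through the corner determined by `x i`. -/
def slab (i : Fin k) (σ : Equiv.Perm (Fin k → ZMod 2)) (p : ZMod 2) (x : Fin k → ZMod 2) :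
    Set ((Fin k → ZMod 2) × ZMod 2 × ZMod 2) :=
  {(x, p, p), (x, p + x i, p + 1 + x i), (σ x, p + x i, p + 1 + x i), (σ x, p + 1, p + 1)}

lemma start_mem_slab (i : Fin k) (σ : Equiv.Perm (Fin k → ZMod 2)) (p : ZMod 2)
    (x : Fin k → ZMod 2) : (x, p, p) ∈ slab i σ p x := Or.inl rfl

lemma end_mem_slab (i : Fin k) (σ : Equiv.Perm (Fin k → ZMod 2)) (p : ZMod 2)
    (x : Fin k → ZMod 2) : (σ x, p + 1, p + 1) ∈ slab i σ p x := Or.inr (Or.inr (Or.inr rfl))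

/-- The product of the hypercube with a four-cycle. -/
abbrev slabGraph (k : ℕ) : SimpleGraph ((Fin k → ZMod 2) × ZMod 2 × ZMod 2) :=
  hypercube k □ ((⊤ : SimpleGraph (ZMod 2)) □ (⊤ : SimpleGraph (ZMod 2)))

lemma cutConnected_slab {i : Fin k} {σ : Equiv.Perm (Fin k → ZMod 2)} (hσ : IsDirectional i σ)
    (p : ZMod 2) (x : Fin k → ZMod 2) : (slabGraph k).CutConnected (slab i σ p x) := by
  refine (((CutConnected.singleton _ _).insert ⟨_, rfl, Or.inr ?_⟩).insert
    ⟨_, Set.mem_insert _ _, ?_⟩).insert ⟨_, Set.mem_insert _ _, Or.inr ?_⟩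
  · rw [boxProd_adj_right]
    simp only [boxProd_adj, top_adj]
    generalize x i = e
    revert p e; decide
  · by_cases h : x = σ x
    · exact Or.inl (by rw [← h])
    · exact Or.inr (boxProd_adj_left.2 (hypercube_adj_of_ne i h fun j hj => (hσ x j hj).symm))
  · rw [boxProd_adj_right]
    simp only [boxProd_adj, top_adj]
    generalize x i = e
    revert p e; decide

/-- Entry and exit corners are distinct and lie on the diagonal, middle corners off it. A middle
corner reveals coordinate `i` of the strand, and the other coordinates do not change under `σ`. -/
lemma eq_of_mem_slab {i : Fin k} {σ : Equiv.Perm (Fin k → ZMod 2)} (hσ : IsDirectional i σ)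
    {p : ZMod 2} {x x' : Fin k → ZMod 2} {z : (Fin k → ZMod 2) × ZMod 2 × ZMod 2}
    (hz : z ∈ slab i σ p x) (hz' : z ∈ slab i σ p x') : x = x' := by
  have h1 : ∀ p e : ZMod 2, p = p + e → p ≠ p + 1 + e := by decide
  have h2 : ∀ p e : ZMod 2, p + 1 = p + e → p + 1 ≠ p + 1 + e := by decide
  have h3 : ∀ p : ZMod 2, p ≠ p + 1 := by decide
  have hfix (y y' : Fin k → ZMod 2) (he : p + y i = p + y' i) (h : y = σ y') : y = y' := by
    rw [h]
    funext j
    by_cases hj : j = i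
    · rw [hj, ← h]; exact add_left_cancel he
    · exact hσ y' j hj
  simp only [slab, Set.mem_insert_iff, Set.mem_singleton_iff] at hz hz'
  rcases hz with rfl | rfl | rfl | rfl <;> simp only [Prod.mk.injEq] at hz' <;>
    rcases hz' with ⟨h, h', h''⟩ | ⟨h, h', h''⟩ | ⟨h, h', h''⟩ | ⟨h, h', h''⟩
  · exact h
  · exact absurd h'' (h1 _ _ h')
  · exact absurd h'' (h1 _ _ h')
  · exact absurd h' (h3 _)
  · exact absurd h''.symm (h1 _ _ h'.symm)
  · exact h
  · exact hfix x x' h' h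
  · exact absurd h''.symm (h2 _ _ h'.symm)
  · exact absurd h''.symm (h1 _ _ h'.symm)
  · exact (hfix x' x h'.symm h.symm).symm
  · exact σ.injective h
  · exact absurd h''.symm (h2 _ _ h'.symm)
  · exact absurd h'.symm (h3 _)
  · exact absurd h'' (h2 _ _ h')
  · exact absurd h'' (h2 _ _ h')
  · exact σ.injective h

/-- The graph on the hypercube in which two vertices are adjacent when they are adjacent in the
hypercube or mapped to adjacent vertices by `π`. -/
def routingGraph (π : Equiv.Perm (Fin k → ZMod 2)) : SimpleGraph (Fin k → ZMod 2) :=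
  hypercube k ⊔ (hypercube k).comap π

/-- The branch set of `x` is its whole strand: cube edges are realised in the first slab, edges
pulled back by the permutation in the last. Taking `p` to be the parity of `j` makes the exit corner
of one slab the entry corner of the next. -/
theorem exists_model_routingGraph {σ : ℕ → Equiv.Perm (Fin k → ZMod 2)}
    (hσ : ∀ j, ∃ i, IsDirectional i (σ j)) (n : ℕ) :
    ∃ B, (routingGraph (compositePerm σ (n + 1))).IsMinorModel
      (slabGraph k □ pathGraph (n + 1)) B := by
  choose ι hι using hσ
  let piece (x : Fin k → ZMod 2) (j : Fin (n + 1)) :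
      Set (((Fin k → ZMod 2) × ZMod 2 × ZMod 2) × Fin (n + 1)) :=
    (fun z => (z, j)) '' slab (ι j) (σ j) ((j : ℕ) : ZMod 2) (compositePerm σ j x)
  have hstart (x : Fin k → ZMod 2) (j : Fin (n + 1)) :
      ((compositePerm σ j x, ((j : ℕ) : ZMod 2), ((j : ℕ) : ZMod 2)), j) ∈ piece x j :=
    ⟨_, start_mem_slab _ _ _ _, rfl⟩
  have hend (x : Fin k → ZMod 2) (j : Fin (n + 1)) :
      ((compositePerm σ (j + 1) x, ((j : ℕ) : ZMod 2) + 1, ((j : ℕ) : ZMod 2) + 1), j) ∈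
        piece x j :=
    ⟨_, end_mem_slab _ _ _ _, rfl⟩
  have hlink (x : Fin k → ZMod 2) (j j' : Fin (n + 1)) (h : (j : ℕ) + 1 = j') :
      ∃ a ∈ piece x j, ∃ b ∈ piece x j', (slabGraph k □ pathGraph (n + 1)).Adj a b := by
    have hb := hstart x j'
    rw [← h, Nat.cast_succ] at hb
    exact ⟨_, hend x j, _, hb, boxProd_adj_right.2 (pathGraph_adj.2 (Or.inl h))⟩
  refine ⟨fun x => ⋃ j ∈ Set.univ, piece x j, fun x => ?_, fun x x' z hz hz' => ?_,
    fun x x' h => ?_⟩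
  · refine (cutConnected_pathGraph ⟨0, Set.mem_univ 0⟩ Set.ordConnected_univ).biUnion
      (fun j _ => (cutConnected_slab (hι j) _ _).map _ fun a b _ h => boxProd_adj_left.2 h)
      fun j _ j' _ h => ?_
    rcases pathGraph_adj.1 h with h | h
    · exact hlink x j j' h
    · obtain ⟨a, ha, b, hb, hab⟩ := hlink x j' j h
      exact ⟨b, hb, a, ha, hab.symm⟩
  · obtain ⟨j, -, y, hy, rfl⟩ := Set.mem_iUnion₂.1 hz
    obtain ⟨j', -, y', hy', h⟩ := Set.mem_iUnion₂.1 hz'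
    obtain ⟨rfl, rfl⟩ := Prod.mk.inj h
    exact (compositePerm σ _).injective (eq_of_mem_slab (hι _) hy hy')
  · rcases h with h | h
    · exact ⟨_, Set.mem_biUnion (Set.mem_univ 0) (hstart x 0), _,
        Set.mem_biUnion (Set.mem_univ 0) (hstart x' 0),
        boxProd_adj_left.2 (boxProd_adj_left.2 h)⟩
    · exact ⟨_, Set.mem_biUnion (Set.mem_univ (Fin.last n)) (hend x (Fin.last n)), _,
        Set.mem_biUnion (Set.mem_univ (Fin.last n)) (hend x' (Fin.last n)),
        boxProd_adj_left.2 (boxProd_adj_left.2 h)⟩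

/-- The four-cycle is a two-dimensional cube, and a Gray code places the path in an $l$-dimensional
one. -/
lemma exists_model_slabGraph_boxProd (k l : ℕ) :
    ∃ B, (slabGraph k □ pathGraph (2 ^ l)).IsMinorModel (hypercube (k + (l + 1 + 1))) B := by
  obtain ⟨g, hg, hadj⟩ := exists_grayCode l
  let f (z : ((Fin k → ZMod 2) × ZMod 2 × ZMod 2) × Fin (2 ^ l)) : Fin (k + (l + 1 + 1)) → ZMod 2 :=
    Fin.append z.1.1 (Fin.cons z.1.2.1 (Fin.cons z.1.2.2 (g z.2) : Fin (l + 1) → ZMod 2))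
  have hf (z z') : hammingDist (f z) (f z') = hammingDist z.1.1 z'.1.1 +
      ((if z.1.2.1 ≠ z'.1.2.1 then 1 else 0) +
        ((if z.1.2.2 ≠ z'.1.2.2 then 1 else 0) + hammingDist (g z.2) (g z'.2))) := by
    rw [hammingDist_append, hammingDist_cons, hammingDist_cons]
  refine ⟨_, isMinorModel_of_injective f ?_ ?_⟩
  · rintro ⟨⟨x, p, q⟩, t⟩ ⟨⟨x', p', q'⟩, t'⟩ h
    have h0 := hf ⟨⟨x, p, q⟩, t⟩ ⟨⟨x', p', q'⟩, t'⟩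
    rw [h, hammingDist_self] at h0
    have hp : p = p' := by by_contra hne; simp [hne] at h0; omega
    have hq : q = q' := by by_contra hne; simp [hne] at h0; omega
    have hx : x = x' := hammingDist_eq_zero.1 (by dsimp only at h0; omega)
    have ht : g t = g t' := hammingDist_eq_zero.1 (by dsimp only at h0; omega)
    rw [hp, hq, hx, Fin.ext (hg t.2 t'.2 ht)]
  · rintro ⟨⟨x, p, q⟩, t⟩ ⟨⟨x', p', q'⟩, t'⟩ h
    change hammingDist _ _ = 1
    rw [hf]
    simp only [boxProd_adj, top_adj, Prod.mk.injEq] at h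
    rcases h with ⟨⟨h, rfl, rfl⟩ | ⟨⟨h, rfl⟩ | ⟨h, rfl⟩, rfl⟩, rfl⟩ | ⟨h, rfl, rfl, rfl⟩
    · simpa using show hammingDist _ _ = 1 from h
    · simp [h]
    · simp [h]
    · have : (hypercube l).Adj (g t) (g t') := by
        rcases pathGraph_adj.1 h with h | h
        · rw [← h]; exact hadj t (h ▸ t'.2)
        · rw [← h]; exact (hadj t' (h ▸ t.2)).symm
      simpa using show hammingDist _ _ = 1 from this

theorem routingGraph_exists_model_hypercube {k l : ℕ} (hk : 0 < k) (hl : 2 * k ≤ 2 ^ l)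
    (π : Equiv.Perm (Fin k → ZMod 2)) :
    ∃ B, (routingGraph π).IsMinorModel (hypercube (k + (l + 1 + 1))) B := by
  obtain ⟨L, hlen, rfl, hdir⟩ := exists_benes_factorization π
  obtain ⟨σ, hσ, hcomp⟩ := exists_directional_sequence ⟨0, hk⟩ L hdir
  obtain ⟨n, hn⟩ := Nat.exists_eq_succ_of_ne_zero (pow_pos two_pos l).ne'
  obtain ⟨B, hB⟩ := exists_model_routingGraph hσ n
  have hslab := exists_model_slabGraph_boxProd k l
  rw [hn] at hslab
  obtain ⟨C, hC⟩ := hslab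
  rw [hcomp (n + 1) (by omega)] at hB
  exact ⟨_, hB.trans hC⟩

end Slab

/-! ### Arbitrary graphs as minors of routing graphs -/

lemma exists_perm_extending {Ω D : Type*} [Finite Ω] {u v : D → Ω} (hu : Function.Injective u)
    (hv : Function.Injective v) : ∃ π : Equiv.Perm Ω, ∀ a, π (u a) = v a := by
  classical
  have := Fintype.ofFinite Ω
  let e : {x // x ∈ Set.range u} ≃ {x // x ∈ Set.range v} :=
    (Equiv.ofInjective u hu).symm.trans (Equiv.ofInjective v hv)
  refine ⟨e.extendSubtype, fun a => ?_⟩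
  rw [e.extendSubtype_apply_of_mem _ ⟨a, rfl⟩]
  change ((Equiv.ofInjective v hv) ((Equiv.ofInjective u hu).symm ⟨u a, a, rfl⟩) : Ω) = v a
  rw [Equiv.ofInjective_symm_apply hu a, Equiv.ofInjective_apply]

/-- Injective enumerations of the darts of a graph in which the two darts of each edge are
consecutive. -/
lemma exists_dart_pairing {W : Type*} [Finite W] (H : SimpleGraph W) :
    ∃ e : H.Dart → ℕ, Function.Injective e ∧ (∀ δ, e δ < 2 * H.edgeSet.ncard) ∧
      ∀ δ, e δ.symm = e δ + 1 ∨ e δ = e δ.symm + 1 := by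
  classical
  have := Fintype.ofFinite W
  let r := @WellOrderingRel W
  let E : H.edgeSet ≃ Fin H.edgeSet.ncard := Finite.equivFinOfCardEq rfl
  let e (δ : H.Dart) : ℕ := 2 * (E ⟨δ.edge, δ.edge_mem⟩ : ℕ) + if r δ.fst δ.snd then 0 else 1
  have hsymm (δ : H.Dart) : r δ.snd δ.fst ↔ ¬ r δ.fst δ.snd := by
    constructor
    · exact fun h h' => asymm_of r h h'
    · intro h
      rcases trichotomous_of r δ.fst δ.snd with h' | h' | h'
      · exact absurd h' h
      · exact absurd h' δ.adj.ne
      · exact h'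
  have he (δ : H.Dart) : e δ.symm =
      2 * (E ⟨δ.edge, δ.edge_mem⟩ : ℕ) + if r δ.fst δ.snd then 1 else 0 := by
    simp only [e, Dart.edge_symm]
    change _ + (if r δ.snd δ.fst then 0 else 1) = _
    rw [hsymm]
    by_cases h : r δ.fst δ.snd <;> simp [h]
  refine ⟨e, fun δ δ' h => ?_, fun δ => ?_, fun δ => ?_⟩
  · have hE : E ⟨δ.edge, δ.edge_mem⟩ = E ⟨δ'.edge, δ'.edge_mem⟩ := by
      refine Fin.ext ?_
      dsimp only [e] at h
      split_ifs at h <;> omega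
    rcases dart_edge_eq_iff δ δ' |>.1 (congrArg Subtype.val (E.injective hE)) with h' | h'
    · exact h'
    · have h1 := he δ'
      rw [← h', h] at h1
      dsimp only [e] at h1
      split_ifs at h1 <;> omega
  · have := (E ⟨δ.edge, δ.edge_mem⟩).2
    dsimp only [e]
    split_ifs <;> omega
  · rw [he]
    dsimp only [e]
    split_ifs <;> omega

/-- An enumeration of the darts of a graph in which the darts starting at each vertex are
consecutive. -/
lemma exists_dart_sorting {W : Type*} [Finite W] (H : SimpleGraph W) :
    ∃ f : Fin (2 * H.edgeSet.ncard) ≃ H.Dart, ∀ w, {a | (f a).fst = w}.OrdConnected := by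
  classical
  have := Fintype.ofFinite W
  let _ : LinearOrder W := linearOrderOfSTO WellOrderingRel
  let _ : LinearOrder H.Dart := LinearOrder.lift' (fun δ : H.Dart => toLex (δ.fst, δ.snd))
    fun δ δ' h => Dart.ext _ _ (toLex.injective h)
  have hcard : Fintype.card H.Dart = 2 * H.edgeSet.ncard := by
    rw [H.dart_card_eq_twice_card_edges, Set.ncard_eq_toFinset_card', edgeFinset]
  let f := Fintype.orderIsoFinOfCardEq H.Dart hcard
  have hmono : Monotone fun a => (f a).fst := by
    intro a b hab
    have h : toLex ((f a).fst, (f a).snd) ≤ toLex ((f b).fst, (f b).snd) := f.monotone hab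
    rcases Prod.Lex.le_iff.1 h with h | h
    · exact h.le
    · exact h.1.le
  exact ⟨f.toEquiv, fun w => Set.ordConnected_singleton.preimage_mono hmono⟩

theorem exists_routingGraph_model {W : Type*} [Finite W] (H : SimpleGraph W)
    (hiso : ∀ w, ¬ H.IsIsolated w) {k : ℕ} (hk : 2 * H.edgeSet.ncard ≤ 2 ^ k) :
    ∃ (π : Equiv.Perm (Fin k → ZMod 2)) (B : _), H.IsMinorModel (routingGraph π) B := by
  obtain ⟨e, he, hlt, hpair⟩ := exists_dart_pairing H
  obtain ⟨f, hf⟩ := exists_dart_sorting H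
  obtain ⟨g, hg, hadj⟩ := exists_grayCode k
  let u (a : Fin (2 * H.edgeSet.ncard)) : Fin k → ZMod 2 := g a
  have hu : Function.Injective u := fun a b h =>
    Fin.ext (hg (a.2.trans_le hk) (b.2.trans_le hk) h)
  obtain ⟨π, hπ⟩ := exists_perm_extending (u := fun δ => u (f.symm δ)) (v := fun δ => g (e δ))
    (hu.comp f.symm.injective)
    fun δ δ' h => he (hg ((hlt δ).trans_le hk) ((hlt δ').trans_le hk) h)
  -- The branch set of `w` is the stretch of Gray code carrying the darts out of `w`; it is nonempty
  -- since `w` is not isolated.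
  refine ⟨π, fun w => u '' {a | (f a).fst = w}, fun w => ?_, ?_, fun w w' h => ?_⟩
  · refine (cutConnected_pathGraph ?_ (hf w)).map _ fun a b _ hab => Or.inl ?_
    · obtain ⟨w', hw'⟩ : ∃ w', H.Adj w w' := by
        by_contra! h
        exact hiso w h
      exact ⟨f.symm ⟨(w, w'), hw'⟩, by simp⟩
    · rcases pathGraph_adj.1 hab with h | h
      · change (hypercube k).Adj (g a) (g b)
        rw [← h]; exact hadj a (by have := b.2; omega)
      · change (hypercube k).Adj (g a) (g b)
        rw [← h]; exact (hadj b (by have := a.2; omega)).symm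
  · rintro w w' _ ⟨a, ha, rfl⟩ ⟨b, hb, hba⟩
    obtain rfl := hu hba
    exact ha.symm.trans hb
  · let δ : H.Dart := ⟨(w, w'), h⟩
    refine ⟨_, ⟨f.symm δ, by simp [δ], rfl⟩, _, ⟨f.symm δ.symm, by simp [δ], rfl⟩, Or.inr ?_⟩
    change (hypercube k).Adj (π _) (π _)
    rw [hπ, hπ]
    have h1 := hlt δ
    have h2 := hlt δ.symm
    rcases hpair δ with h | h
    · rw [h]; exact hadj _ (by omega)
    · rw [h]; exact (hadj _ (by omega)).symm

/-! ### Choice of dimensions -/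

theorem isMinorUniversal_hypercube {d : ℕ} (hd : 1 ≤ d) :
    (hypercube d).IsMinorUniversal (1 / 32 * 2 ^ d / d) := by
  intro W _ H hiso hcard
  have hd' : (0 : ℝ) < d := by exact_mod_cast hd
  rw [le_div_iff₀ hd'] at hcard
  have hcard' : H.edgeSet.ncard * (32 * d) ≤ 2 ^ d := by
    have : (H.edgeSet.ncard : ℝ) * (32 * d) ≤ 2 ^ d := by linarith
    exact_mod_cast this
  rcases Nat.eq_zero_or_pos H.edgeSet.ncard with h0 | hpos
  · have hempty : IsEmpty W := by
      refine ⟨fun w => hiso w fun w' h => ?_⟩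
      have : s(w, w') ∈ H.edgeSet := h
      rw [(Set.ncard_eq_zero (Set.toFinite _)).1 h0] at this
      exact this
    exact IsMinorModel.isMinor (B := fun _ => ∅)
      ⟨fun w => isEmptyElim w, fun w => isEmptyElim w, fun w => isEmptyElim w⟩
  · obtain ⟨l, hlow, hhigh⟩ : ∃ l, d < 2 ^ l ∧ 2 ^ l ≤ 2 * d := by
      refine ⟨Nat.log 2 d + 1, Nat.lt_pow_succ_log_self one_lt_two d, ?_⟩
      rw [pow_succ, mul_comm]
      exact Nat.mul_le_mul_left 2 (Nat.pow_log_le_self 2 (by omega))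
    -- The constant 32 arises as $8\cdot 2\cdot 2$, from $2^{l+3}\le 8\cdot 2d$ and two darts per
    -- edge.
    have hlarge : 2 ^ (l + 1 + 2) * (2 * H.edgeSet.ncard) ≤ 2 ^ d := by
      rw [pow_add, pow_add]
      nlinarith
    have hld : l + 1 + 2 < d := by
      refine (Nat.pow_lt_pow_iff_right one_lt_two).1 (lt_of_lt_of_le ?_ hlarge)
      have : 0 < 2 ^ (l + 1 + 2) := by positivity
      nlinarith
    -- Two dimensions go to the four-cycle and $l+1$ to the path, whose $2^{l+1}>2d$ slabs exceed
    -- the $2k$ needed.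
    obtain ⟨k, rfl⟩ : ∃ k, d = k + (l + 1 + 1 + 1) := ⟨d - (l + 3), by omega⟩
    have hk : 2 * H.edgeSet.ncard ≤ 2 ^ k := by
      refine le_of_mul_le_mul_left ?_ (pow_pos two_pos (l + 1 + 2))
      rw [← pow_add, add_comm _ k]
      exact hlarge
    obtain ⟨π, B, hB⟩ := exists_routingGraph_model H hiso hk
    obtain ⟨C, hC⟩ := routingGraph_exists_model_hypercube (l := l + 1) (by omega)
      (by rw [pow_succ]; omega) π
    exact (hB.trans hC).isMinor

end SimpleGraph

theorem theoremA :
    (∃ c : ℝ, 0 < c ∧ ∀ d : ℕ, 1 ≤ d →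
      (SimpleGraph.hypercube d).IsMinorUniversal (c * 2 ^ d / d)) ∧
    (∃ C : ℝ, 0 < C ∧ ∀ d : ℕ, 1 ≤ d →
      ¬ (SimpleGraph.hypercube d).IsMinorUniversal (C * 2 ^ d / Real.sqrt d)) :=
  ⟨⟨1 / 32, by norm_num, fun _ => SimpleGraph.isMinorUniversal_hypercube⟩,
    84, by norm_num, fun _ => SimpleGraph.not_isMinorUniversal_hypercube⟩
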